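/- Wireless links. A network is a finite set $L=\{\ell_1,\dots,\ell_n\}$ of distinct links $\ell_i=(s_i,r_i)$ (sender, receiver) in the Euclidean plane, normalized so that $\min_{i,j} d(s_i,r_j)=1$; let $\Delta=\max_i d(s_i,r_i)\ge 1$. Fix a path-loss exponent $\alpha>0$, an SINR threshold $\beta>1$, a noise level $N\ge 0$ and a maximum power $P_{\max}\in\mathbb{N}$. With power control, each link $\ell_i$ chooses an integer power $P_i\in\{0,1,\dots,P_{\max}\}$; link $\ell_j$ is successful if $P_j>0$ and $$\frac{P_j}{d(s_j,r_j)^{\alpha}}\ \ge\ \beta\Big(N+\sum_{i\ne j}\frac{P_i}{d(s_i,r_j)^{\alpha}}\Big).$$ A set of links is feasible if, for some choice of powers with all other links silent, all its links are successful; $OPT$ is the maximum size of a feasible set. In the power-control game a link has utility $0$ if $P_i=0$, $1$ if it is successful, and $-1$ if it transmits unsuccessfully. The regret of a link in a history of $T\ge1$ strategy profiles is the best average utility it could have had by playing one fixed power in all rounds (the other links' play unchanged) minus its actual average utility; an $\varepsilon$-regret history is one in which every link has regret at most $\varepsilon$. The value of a history is the average number of successful links per round, and the price of total anarchy $\mathrm{PoTA}_\varepsilon(L)$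 is $OPT$ divided by the infimum of the values of all $\varepsilon$-regret histories (with $0/0=0$, and $x/0=\infty$ for $x>0$). Theorem. The price of total anarchy under power control is $\Theta(\log\Delta)$ in the worst case. Precisely, there is an absolute constant $\varepsilon_0>0$ such that for all $\alpha>0$ and $\beta>1$ there are constants $c,C>0$, depending only on $\alpha$ and $\beta$, with the following properties. 1. For every $N\ge0$, every $P_{\max}\in\mathbb{N}$, every network $L$ of $n$ links, and every $0\le\varepsilon\le\varepsilon_0/n$, $$\mathrm{PoTA}_\varepsilon(L)\ \le\ C\,(1+\log\Delta).$$ 2. For every $N\ge0$ and every real $\Delta\ge1$ there are a network $L$ with maximal link length exactly $\Delta$ and a number $P_0$ such that for every integer $P_{\max}\ge P_0$ and every $\varepsilon\ge0$, $$\mathrm{PoTA}_\varepsilon(L)\ \ge\ c\,(1+\log\Delta).$$ (For $\Delta\ge2$ the factor $1+\log\Delta$ is equivalent to $\log\Delta$, up to constants.) -/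

import Mathlib

open scoped ENNReal

/-- The Euclidean plane. -/
abbrev Plane : Type := EuclideanSpace ℝ (Fin 2)

/-- A set of `n` links (sender, receiver) in the plane, with distances normalized so that the
smallest sender-receiver distance (over all pairs, not only over links) is exactly `1`. -/
structure LinkNetwork (n : ℕ) where
  sender : Fin n → Plane
  receiver : Fin n → Plane
  distinct : Function.Injective fun i => (sender i, receiver i)
  one_le_dist : ∀ i j, 1 ≤ dist (sender i) (receiver j)
  exists_dist_eq_one : ∃ i j, dist (sender i) (receiver j) = 1

/-- Parameters of the physical model: path-loss exponent, SINR threshold, background noise and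
maximum transmission power. -/
structure RadioParams where
  pathLoss : ℝ
  threshold : ℝ
  noise : ℝ
  maxPower : ℕ

/-- The strategies of a link with power control: integer powers `0, 1, …, maxPower`. -/
abbrev RadioParams.Power (M : RadioParams) : Type := Fin (M.maxPower + 1)

/-- A strategy profile: one power for each link. -/
abbrev RadioParams.Profile (M : RadioParams) (n : ℕ) : Type := Fin n → M.Power

namespace LinkNetwork

noncomputable section

variable {n : ℕ} (L : LinkNetwork n) (M : RadioParams)

/-- The maximal link length `Δ`. -/
def maxLength : ℝ := ⨆ i : Fin n, dist (L.sender i) (L.receiver i)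

/-- The strength at receiver `j` of the signal of sender `i`. -/
def received (a : M.Profile n) (i j : Fin n) : ℝ :=
  ((a i : ℕ) : ℝ) / dist (L.sender i) (L.receiver j) ^ M.pathLoss

/-- Link `j` transmits and its SINR is at least the threshold. The SINR inequality is written
without division, so that a vanishing denominator counts as an infinite SINR. -/
def Succeeds (a : M.Profile n) (j : Fin n) : Prop :=
  0 < (a j : ℕ) ∧
    M.threshold * ((∑ i ∈ Finset.univ.erase j, L.received M a i j) + M.noise)
      ≤ L.received M a j j

/-- A set of links is feasible if some powers, with the other links silent, make all of its
links successful. -/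
def IsFeasible (A : Finset (Fin n)) : Prop :=
  ∃ a : M.Profile n, (∀ i, i ∉ A → a i = 0) ∧ ∀ i ∈ A, L.Succeeds M a i

open Classical in
/-- The size of a maximum feasible set of links. -/
def opt : ℕ := (Finset.univ.filter fun A : Finset (Fin n) => L.IsFeasible M A).sup Finset.card

open Classical in
/-- The utility of link `i`: `0` if silent, `1` if successful, `-1` if it transmits in vain. -/
def utility (a : M.Profile n) (i : Fin n) : ℝ :=
  if a i = 0 then 0 else if L.Succeeds M a i then 1 else -1

/-- The regret of link `i` in a history of `T` rounds. -/
def regret {T : ℕ} (H : Fin T → M.Profile n) (i : Fin n) : ℝ :=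
  (⨆ s : M.Power, (1 / (T : ℝ)) * ∑ t, L.utility M (Function.update (H t) i s) i)
    - (1 / (T : ℝ)) * ∑ t, L.utility M (H t) i

/-- A history in which every link has regret at most `ε`. -/
def IsRegretHistory (ε : ℝ) {T : ℕ} (H : Fin T → M.Profile n) : Prop :=
  ∀ i, L.regret M H i ≤ ε

open Classical in
/-- The number of successful links, averaged over the rounds of a history. -/
def value {T : ℕ} (H : Fin T → M.Profile n) : ℝ :=
  (1 / (T : ℝ)) * ∑ t, ((Finset.univ.filter fun i => L.Succeeds M (H t) i).card : ℝ)

/-- The value of the worst `ε`-regret history (of any positive number of rounds). -/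
def worstRegretValue (ε : ℝ) : ℝ≥0∞ :=
  ⨅ (T : ℕ) (_ : 0 < T) (H : Fin T → M.Profile n) (_ : L.IsRegretHistory M ε H),
    ENNReal.ofReal (L.value M H)

/-- The price of total anarchy: the optimum divided by the value of the worst `ε`-regret history.
It is `∞` if the latter is `0` and the optimum is not. -/
def priceOfTotalAnarchy (ε : ℝ) : ℝ≥0∞ :=
  (L.opt M : ℝ≥0∞) / L.worstRegretValue M ε

end

end LinkNetwork

/-!
The price of total anarchy of power control is of order `log Δ`.

*Upper bound.* In a history of low regret, a link transmits in vain at most about as often as it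
succeeds (compare with staying silent), and a link with few successes would fail at maximum power
in about half of the rounds (compare with always transmitting at maximum power). So it is enough
to see that a round with few transmissions blocks few links of a feasible set. A feasible set is
cut into about `log Δ` classes of links of nearly equal length. Within a class, the individual
powers can be forgotten. If noise is a minor obstacle, then of two links one has at least the
power of the other, while the two cross distances agree up to a constant
(`Succeeds.gap_le_mul_gap`), so that the total load of the class on itself at *uniform* maximum
power is at most proportional to its size (`sum_load_le_of_low_noise`); if noise is a major
obstacle, all powers are within a factor two of the maximum anyway (`sum_load_le_of_high_power`).
Half of the class then puts out a bounded load per link, and comparing an arbitrary sender with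
the link whose receiver is nearest to it shows that this sender, too, puts a bounded load on that
half (`sum_min_load_le`). A blocked link is overloaded, hence each transmission blocks boundedly
many links of the class, and the class is at most a constant times larger than the value of the
history (`card_le_mul_value`). The additive error caused by the regret, at most `1 / 6` per round
in total, is absorbed because the value is at least `1 / 10` as soon as one link can overcome the
noise (`one_le_ten_mul_value`).

*Lower bound.* Concentric links on a line with geometrically growing lengths `ρ ^ i` can all
succeed together when link `i` has power about `ρ ^ (i * α / 2)` (`isFeasible_nested`). But the
profile in which the shortest link uses the maximum power and the others are silent is an
equilibrium with a single success (`worstRegretValue_nested_le`), for the shortest sender is at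
least as close to every receiver as the intended one.
-/

namespace LinkNetwork

/-! ### Loads at maximum power -/

section Load

variable {n : ℕ} (L : LinkNetwork n) (M : RadioParams)

/-- The distance from the sender of link `j` to the receiver of link `i`. -/
noncomputable def gap (j i : Fin n) : ℝ := dist (L.sender j) (L.receiver i)

/-- What is left of the signal of link `i` at maximum power when the noise is taken out, per unit of
power: at maximum power link `i` tolerates interference up to
`maxPower * slack i / threshold`. (Meaningful for positive `maxPower` only.) -/
noncomputable def slack (i : Fin n) : ℝ :=
  1 / L.gap i i ^ M.pathLoss - M.threshold * M.noise / M.maxPower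

/-- The fraction of the tolerance of link `i` (at maximum power) that is used up by a sender at the
point `x` transmitting at maximum power. It is meaningful only for positive slack. -/
noncomputable def load (x : Plane) (i : Fin n) : ℝ :=
  M.threshold / (L.slack M i * dist x (L.receiver i) ^ M.pathLoss)

variable {L M}

lemma gap_pos (j i : Fin n) : 0 < L.gap j i := zero_lt_one.trans_le (L.one_le_dist j i)

lemma gap_rpow_pos (j i : Fin n) (p : ℝ) : 0 < L.gap j i ^ p := Real.rpow_pos_of_pos (gap_pos j i) p

lemma gap_le (i j : Fin n) : L.gap i j ≤ L.gap i i + L.gap j i + L.gap j j := by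
  have h := dist_triangle4 (L.sender i) (L.receiver i) (L.sender j) (L.receiver j)
  rwa [dist_comm (L.receiver i)] at h

lemma load_nonneg (hβ : 0 ≤ M.threshold) {x : Plane} {i : Fin n} (hi : 0 ≤ L.slack M i) :
    0 ≤ L.load M x i := by
  unfold load; positivity

lemma slack_le (hβ : 0 ≤ M.threshold) (hN : 0 ≤ M.noise) (i : Fin n) :
    L.slack M i ≤ 1 / L.gap i i ^ M.pathLoss := by
  have : 0 ≤ M.threshold * M.noise / M.maxPower := by positivity
  unfold slack; linarith

/-- Let links of nearly equal length put only a bounded load on one another. Then an arbitrary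
sender loads them only boundedly: it loads each of them at most `4 ^ α` times as much as does the
link whose receiver is nearest to it. -/
lemma sum_min_load_le (hα : 0 < M.pathLoss) (hβ : 1 < M.threshold) (hN : 0 ≤ M.noise)
    {S : Finset (Fin n)} {R K : ℝ} (hy : ∀ i ∈ S, 0 < L.slack M i)
    (hR : ∀ i ∈ S, R ≤ L.gap i i ∧ L.gap i i ≤ 2 * R) (hK : 0 ≤ K)
    (hout : ∀ j ∈ S, ∑ i ∈ S.erase j, L.load M (L.sender j) i ≤ K)
    (x : Plane) (hx : ∀ i, 0 < dist x (L.receiver i)) :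
    ∑ i ∈ S, min 1 (L.load M x i) ≤ 1 + 4 ^ M.pathLoss * K := by
  have h4 : (0 : ℝ) < 4 ^ M.pathLoss := by positivity
  rcases S.eq_empty_or_nonempty with rfl | hS
  · simp only [Finset.sum_empty]; positivity
  obtain ⟨k, hk, hmin⟩ := S.exists_min_image (fun i => dist x (L.receiver i)) hS
  rw [← Finset.add_sum_erase _ _ hk]
  refine add_le_add (min_le_left _ _) ?_
  refine le_trans ?_ (mul_le_mul_of_nonneg_left (hout k hk) h4.le)
  rw [Finset.mul_sum]
  refine Finset.sum_le_sum fun i hi => ?_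
  have hiS := Finset.mem_of_mem_erase hi
  have hyi := hy i hiS
  have hg : 0 < dist (L.sender k) (L.receiver i) := gap_pos k i
  have hxi := hx i
  have htri : L.gap k i ≤ 2 * R + 2 * dist x (L.receiver i) := by
    have h := dist_triangle4 (L.sender k) (L.receiver k) x (L.receiver i)
    rw [dist_comm (L.receiver k) x] at h
    have h1 : dist (L.sender k) (L.receiver k) ≤ 2 * R := (hR k hk).2
    have h2 := hmin i hiS
    unfold gap; linarith
  unfold load
  rcases le_total R (dist x (L.receiver i)) with hfar | hnear
  · refine (min_le_right _ _).trans ?_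
    have hle : dist (L.sender k) (L.receiver i) ^ M.pathLoss
        ≤ 4 ^ M.pathLoss * dist x (L.receiver i) ^ M.pathLoss := by
      rw [← Real.mul_rpow (by norm_num) hxi.le]
      refine Real.rpow_le_rpow hg.le ?_ hα.le
      unfold gap at htri; linarith
    rw [mul_div_assoc', div_le_div_iff₀ (by positivity) (by positivity)]
    calc M.threshold * (L.slack M i * dist (L.sender k) (L.receiver i) ^ M.pathLoss)
        ≤ M.threshold * (L.slack M i * (4 ^ M.pathLoss * dist x (L.receiver i) ^ M.pathLoss)) := by
          gcongr
      _ = _ := by ring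
  · refine (min_le_left _ _).trans ?_
    have hle : dist (L.sender k) (L.receiver i) ^ M.pathLoss
        ≤ 4 ^ M.pathLoss * L.gap i i ^ M.pathLoss := by
      rw [← Real.mul_rpow (by norm_num) (gap_pos i i).le]
      refine Real.rpow_le_rpow hg.le ?_ hα.le
      have := (hR i hiS).1
      unfold gap at htri this ⊢; linarith
    have hs := slack_le (L := L) (zero_le_one.trans hβ.le) hN i
    rw [mul_div_assoc', le_div_iff₀ (by positivity), one_mul]
    have hp := gap_rpow_pos (L := L) i i M.pathLoss
    calc L.slack M i * dist (L.sender k) (L.receiver i) ^ M.pathLoss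
        ≤ 1 / L.gap i i ^ M.pathLoss * (4 ^ M.pathLoss * L.gap i i ^ M.pathLoss) := by gcongr
      _ = 4 ^ M.pathLoss * 1 := by field_simp
      _ ≤ 4 ^ M.pathLoss * M.threshold := by gcongr

/-- A round of play with the power of link `i` raised to the maximum fails link `i` only if the
transmitting links overload it. -/
lemma one_le_sum_min_load (hβ : 1 < M.threshold) (hP : 0 < M.maxPower)
    (a : M.Profile n) {i : Fin n} (hy : 0 < L.slack M i)
    (hfail : ¬ L.Succeeds M (Function.update a i (Fin.last _)) i) :
    1 ≤ ∑ j with a j ≠ 0, min 1 (L.load M (L.sender j) i) := by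
  have hβ0 : 0 < M.threshold := by linarith
  have hP' : (0 : ℝ) < M.maxPower := by exact_mod_cast hP
  have hnn : ∀ j, 0 ≤ L.load M (L.sender j) i := fun j => load_nonneg hβ0.le hy.le
  have hmnn : ∀ j, 0 ≤ min 1 (L.load M (L.sender j) i) := fun j => le_min zero_le_one (hnn j)
  by_cases hbig : ∃ j, a j ≠ 0 ∧ 1 ≤ L.load M (L.sender j) i
  · obtain ⟨j, hj, h1⟩ := hbig
    refine le_trans ?_ (Finset.single_le_sum (fun k _ => hmnn k)
      (Finset.mem_filter.2 ⟨Finset.mem_univ j, hj⟩))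
    rw [min_eq_left h1]
  push Not at hbig
  have hsum : ∑ j with a j ≠ 0, min 1 (L.load M (L.sender j) i)
      = ∑ j with a j ≠ 0, L.load M (L.sender j) i :=
    Finset.sum_congr rfl fun j hj => min_eq_right (hbig j (Finset.mem_filter.1 hj).2).le
  rw [hsum]
  simp only [Succeeds, Function.update_self, Fin.val_last, hP, true_and, not_le, received] at hfail
  have hint : ∑ j ∈ Finset.univ.erase i, ((Function.update a i (Fin.last _) j : ℕ) : ℝ)
        / dist (L.sender j) (L.receiver i) ^ M.pathLoss
      ≤ (M.maxPower * L.slack M i / M.threshold)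
        * ∑ j with a j ≠ 0, L.load M (L.sender j) i := by
    rw [Finset.mul_sum, Finset.sum_filter]
    refine (Finset.sum_le_sum fun j hj => ?_).trans
      (Finset.sum_le_sum_of_subset_of_nonneg (Finset.erase_subset i Finset.univ) fun j _ _ => ?_)
    · rw [Function.update_of_ne (Finset.ne_of_mem_erase hj)]
      split_ifs with h
      · have hg := gap_rpow_pos (L := L) j i M.pathLoss
        have hle : ((a j : ℕ) : ℝ) ≤ M.maxPower := by
          exact_mod_cast Nat.lt_succ_iff.1 (a j).isLt
        unfold load
        unfold gap at hg
        calc ((a j : ℕ) : ℝ) / dist (L.sender j) (L.receiver i) ^ M.pathLoss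
            ≤ M.maxPower / dist (L.sender j) (L.receiver i) ^ M.pathLoss := by gcongr
          _ = _ := by field_simp
      · simp only [not_not] at h
        simp [h]
    · split_ifs
      · have := hnn j; positivity
      · exact le_rfl
  set I := ∑ j ∈ Finset.univ.erase i, ((Function.update a i (Fin.last _) j : ℕ) : ℝ)
        / dist (L.sender j) (L.receiver i) ^ M.pathLoss
  set W := ∑ j with a j ≠ 0, L.load M (L.sender j) i
  have hs : M.maxPower * L.slack M i
      = M.maxPower / dist (L.sender i) (L.receiver i) ^ M.pathLoss - M.threshold * M.noise := by
    unfold slack gap; field_simp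
  have h1 : M.maxPower * L.slack M i < M.threshold * I := by linarith
  have h2 : M.threshold * I ≤ M.maxPower * L.slack M i * W := by
    calc M.threshold * I ≤ M.threshold * (M.maxPower * L.slack M i / M.threshold * W) := by gcongr
      _ = _ := by field_simp
  have h3 : 0 < M.maxPower * L.slack M i := by positivity
  by_contra! hlt
  nlinarith

end Load

/-! ### Counting rounds of a low-regret history -/

section Regret

variable {n : ℕ} (L : LinkNetwork n) (M : RadioParams) {T : ℕ} (H : Fin T → M.Profile n)

/-- The number of rounds in which link `i` transmits. -/
noncomputable def transmissions {M : RadioParams} {T : ℕ} (H : Fin T → M.Profile n) (i : Fin n) :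
    ℝ :=
  ∑ t, if H t i = 0 then 0 else 1

open Classical in
/-- The number of rounds in which link `i` is successful. -/
noncomputable def successes (i : Fin n) : ℝ := ∑ t, if L.Succeeds M (H t) i then 1 else 0

open Classical in
/-- The number of rounds in which link `i` would fail at maximum power. -/
noncomputable def blockings (i : Fin n) : ℝ :=
  ∑ t, if L.Succeeds M (Function.update (H t) i (Fin.last _)) i then 0 else 1

variable {L M H}

lemma successes_nonneg (i : Fin n) : 0 ≤ L.successes M H i :=
  Finset.sum_nonneg fun t _ => by split_ifs <;> norm_num

lemma Succeeds.ne_zero {a : M.Profile n} {i : Fin n} (h : L.Succeeds M a i) : a i ≠ 0 := by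
  intro h0
  have := h.1
  simp [h0] at this

lemma successes_le_transmissions (i : Fin n) : L.successes M H i ≤ transmissions H i :=
  Finset.sum_le_sum fun t _ => by
    by_cases h : L.Succeeds M (H t) i
    · simp [h, h.ne_zero]
    · simp only [h, if_false]; split_ifs <;> norm_num

lemma sum_successes (hT : 0 < T) : ∑ i, L.successes M H i = T * L.value M H := by
  have : (T : ℝ) ≠ 0 := by positivity
  unfold successes value
  rw [Finset.sum_comm, ← mul_assoc, mul_one_div_cancel this, one_mul]
  refine Finset.sum_congr rfl fun t _ => ?_
  rw [Finset.sum_boole]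

lemma sum_utility (i : Fin n) :
    ∑ t, L.utility M (H t) i = 2 * L.successes M H i - transmissions H i := by
  unfold successes transmissions
  rw [Finset.mul_sum, ← Finset.sum_sub_distrib]
  refine Finset.sum_congr rfl fun t _ => ?_
  unfold utility
  by_cases h : L.Succeeds M (H t) i
  · simp only [h, h.ne_zero, if_true, if_false]; norm_num
  · simp only [h, if_false]; split_ifs <;> norm_num

/-- No fixed power would have gained a link of an `ε`-regret history more than `T * ε`. -/
lemma sum_utility_update_le (hT : 0 < T) {ε : ℝ} (hH : L.IsRegretHistory M ε H) (i : Fin n)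
    (s : M.Power) :
    ∑ t, L.utility M (Function.update (H t) i s) i
      ≤ 2 * L.successes M H i - transmissions H i + T * ε := by
  have hT' : (0 : ℝ) < T := by exact_mod_cast hT
  have h := hH i
  unfold regret at h
  have hs := le_ciSup (f := fun s : M.Power =>
    (1 / (T : ℝ)) * ∑ t, L.utility M (Function.update (H t) i s) i) (Set.finite_range _).bddAbove s
  rw [← sum_utility]
  have h2 : (1 / (T : ℝ)) * (∑ t, L.utility M (Function.update (H t) i s) i
      - ∑ t, L.utility M (H t) i) ≤ ε := by
    rw [mul_sub]; linarith
  rw [one_div_mul_eq_div, div_le_iff₀ hT'] at h2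
  linarith

lemma transmissions_le (hT : 0 < T) {ε : ℝ} (hH : L.IsRegretHistory M ε H) (i : Fin n) :
    transmissions H i ≤ 2 * L.successes M H i + T * ε := by
  have h := sum_utility_update_le hT hH i 0
  simp only [utility, Function.update_self, if_true, Finset.sum_const_zero] at h
  linarith

lemma le_blockings (hP : 0 < M.maxPower) (hT : 0 < T) {ε : ℝ} (hH : L.IsRegretHistory M ε H)
    (i : Fin n) :
    (T : ℝ) ≤ 2 * L.blockings M H i + L.successes M H i + T * ε := by
  have h := sum_utility_update_le hT hH i (Fin.last _)
  have hl : (Fin.last M.maxPower : M.Power) ≠ 0 := by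
    simp [Fin.ext_iff]; omega
  have h2 : ∑ t, L.utility M (Function.update (H t) i (Fin.last _)) i
      = T - 2 * L.blockings M H i := by
    unfold blockings
    rw [Finset.mul_sum, show (T : ℝ) = ∑ t : Fin T, (1 : ℝ) by simp, ← Finset.sum_sub_distrib]
    refine Finset.sum_congr rfl fun t _ => ?_
    simp only [utility, Function.update_self, hl, if_false]
    split_ifs <;> norm_num
  have h3 := successes_le_transmissions (L := L) (H := H) i
  linarith

lemma sum_transmissions_le (hT : 0 < T) {ε : ℝ} (hε : ε ≤ 1 / 6 / n)
    (hH : L.IsRegretHistory M ε H) :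
    ∑ i, transmissions H i ≤ 2 * (T * L.value M H) + T / 6 := by
  have hn : (0 : ℝ) < n := by
    obtain ⟨i, -⟩ := L.exists_dist_eq_one
    exact_mod_cast i.pos
  rw [← sum_successes hT, Finset.mul_sum]
  refine (Finset.sum_le_sum fun i _ => transmissions_le hT hH i).trans ?_
  rw [Finset.sum_add_distrib]
  simp only [Finset.sum_const, Finset.card_univ, Fintype.card_fin, nsmul_eq_mul]
  have : (T : ℝ) * (n * ε) ≤ T * (1 / 6) := by
    gcongr
    rw [le_div_iff₀ hn] at hε
    linarith
  linarith

/-- If some link is able to overcome the noise, then an average round of a low-regret history has a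
positive amount of success: that link is blocked only while another one transmits. -/
lemma one_le_ten_mul_value (hP : 0 < M.maxPower) (hT : 0 < T) {ε : ℝ} (hε : ε ≤ 1 / 6 / n)
    (hH : L.IsRegretHistory M ε H) {i : Fin n}
    (hi : M.threshold * M.noise ≤ M.maxPower / L.gap i i ^ M.pathLoss) :
    1 ≤ 10 * L.value M H := by
  have hT' : (0 : ℝ) < T := by exact_mod_cast hT
  have hn : (1 : ℝ) ≤ n := by exact_mod_cast i.pos
  have hε6 : ε ≤ 1 / 6 := hε.trans (div_le_self (by norm_num) hn)
  have hb : L.blockings M H i ≤ ∑ j, transmissions H j := by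
    unfold blockings transmissions
    rw [Finset.sum_comm]
    refine Finset.sum_le_sum fun t _ => ?_
    have hnn : ∀ j : Fin n, (0 : ℝ) ≤ if H t j = 0 then 0 else 1 := fun j => by
      split_ifs <;> norm_num
    split_ifs with h
    · exact Finset.sum_nonneg fun j _ => hnn j
    by_cases hex : ∃ j, j ≠ i ∧ H t j ≠ 0
    · obtain ⟨j, -, hj⟩ := hex
      refine le_trans ?_ (Finset.single_le_sum (fun k _ => hnn k) (Finset.mem_univ j))
      simp [hj]
    · push Not at hex
      refine absurd ⟨by simpa using hP, ?_⟩ h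
      rw [Finset.sum_eq_zero]
      · simpa [received, gap] using hi
      · intro j hj
        have hj' := Finset.ne_of_mem_erase hj
        simp [received, Function.update_of_ne hj', hex j hj']
  have h1 := le_blockings hP hT hH i
  have h2 := sum_transmissions_le hT hε hH
  have h3 : L.successes M H i ≤ T * L.value M H := by
    rw [← sum_successes hT]
    exact Finset.single_le_sum (fun j _ => successes_nonneg j) (Finset.mem_univ i)
  have h4 : (T : ℝ) * ε ≤ T * (1 / 6) := by gcongr
  have h5 : (T : ℝ) * 1 ≤ T * (10 * L.value M H) := by linarith
  exact le_of_mul_le_mul_left h5 hT'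

/-- A set of links of nearly equal length with a bounded total load on one another is at most a
constant factor larger than the value of a low-regret history: most rounds block most of the
links, and by `sum_min_load_le` this takes proportionally many transmissions. -/
lemma card_le_mul_value (hα : 0 < M.pathLoss) (hβ : 1 < M.threshold) (hN : 0 ≤ M.noise)
    (hP : 0 < M.maxPower) (hT : 0 < T) {ε : ℝ} (hε : ε ≤ 1 / 6 / n)
    (hH : L.IsRegretHistory M ε H) (hV : 1 ≤ 10 * L.value M H)
    {S : Finset (Fin n)} {R K : ℝ} (hy : ∀ i ∈ S, 0 < L.slack M i)
    (hR : ∀ i ∈ S, R ≤ L.gap i i ∧ L.gap i i ≤ 2 * R) (hK : 0 < K)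
    (hS : ∑ i ∈ S, ∑ j ∈ S.erase i, L.load M (L.sender j) i ≤ K * S.card) :
    (S.card : ℝ) ≤ (20 + 20 * 4 ^ M.pathLoss * (2 * K)) * L.value M H := by
  classical
  have hT' : (0 : ℝ) < T := by exact_mod_cast hT
  have h4 : (0 : ℝ) < 4 ^ M.pathLoss := by positivity
  have hβ0 : 0 ≤ M.threshold := by linarith
  set V := L.value M H
  set C := 1 + 4 ^ M.pathLoss * (2 * K) with hC
  have hC0 : 1 ≤ C := by rw [hC]; nlinarith [mul_pos h4 hK]
  set out : Fin n → ℝ := fun j => ∑ i ∈ S.erase j, L.load M (L.sender j) i with hout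
  have hout0 : ∀ j ∈ S, 0 ≤ out j := fun j _ => Finset.sum_nonneg fun i hi =>
    load_nonneg hβ0 (hy i (Finset.mem_of_mem_erase hi)).le
  -- Total outgoing and total incoming load agree, so half of the links put out at most `2 * K`.
  have hswap : ∑ j ∈ S, out j ≤ K * S.card := by
    refine le_of_eq_of_le ?_ hS
    simp only [hout]
    refine Finset.sum_comm' fun i j => ?_
    simp only [Finset.mem_erase]
    constructor
    · rintro ⟨h1, h2, h3⟩
      exact ⟨⟨h2.symm, h1⟩, h3⟩
    · rintro ⟨⟨h1, h2⟩, h3⟩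
      exact ⟨h2, h1.symm, h3⟩
  set S₀ := S.filter fun j => out j ≤ 2 * K
  have hsub : S₀ ⊆ S := Finset.filter_subset _ _
  have hhalf : (S.card : ℝ) ≤ 2 * S₀.card := by
    have hcard : (S.card : ℝ) = S₀.card + (S.filter fun j => ¬ out j ≤ 2 * K).card := by
      exact_mod_cast (Finset.card_filter_add_card_filter_not (s := S) fun j => out j ≤ 2 * K).symm
    have h1 : (S.filter fun j => ¬ out j ≤ 2 * K).card * (2 * K) ≤ ∑ j ∈ S, out j := by
      rw [← nsmul_eq_mul]
      refine (Finset.card_nsmul_le_sum _ out _ fun j hj => ?_).trans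
        (Finset.sum_le_sum_of_subset_of_nonneg (Finset.filter_subset _ _) fun j hj _ => hout0 j hj)
      exact (not_le.1 (Finset.mem_filter.1 hj).2).le
    have h2 : ((S.filter fun j => ¬ out j ≤ 2 * K).card : ℝ) * 2 ≤ S.card := by
      refine le_of_mul_le_mul_right ?_ hK
      linarith
    linarith
  -- In each round, the number of blocked links is at most `C` times that of transmitting ones.
  have hblock : ∑ i ∈ S₀, L.blockings M H i ≤ C * ∑ j, transmissions H j := by
    unfold blockings transmissions
    rw [Finset.sum_comm, Finset.sum_comm (s := (Finset.univ : Finset (Fin n))), Finset.mul_sum]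
    refine Finset.sum_le_sum fun t _ => ?_
    calc ∑ i ∈ S₀, (if L.Succeeds M (Function.update (H t) i (Fin.last _)) i then (0 : ℝ) else 1)
        ≤ ∑ i ∈ S₀, ∑ j with H t j ≠ 0, min 1 (L.load M (L.sender j) i) := by
          refine Finset.sum_le_sum fun i hi => ?_
          have hyi := hy i (hsub hi)
          split_ifs with h
          · exact Finset.sum_nonneg fun j _ => le_min zero_le_one (load_nonneg hβ0 hyi.le)
          · exact one_le_sum_min_load hβ hP _ hyi h
      _ = ∑ j with H t j ≠ 0, ∑ i ∈ S₀, min 1 (L.load M (L.sender j) i) := Finset.sum_comm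
      _ ≤ ∑ j with H t j ≠ 0, C := by
          refine Finset.sum_le_sum fun j _ => ?_
          refine sum_min_load_le hα hβ hN (fun i hi => hy i (hsub hi)) (fun i hi => hR i (hsub hi))
            (by positivity) (fun k hk => ?_) _ fun i => gap_pos j i
          refine le_trans ?_ (Finset.mem_filter.1 hk).2
          exact Finset.sum_le_sum_of_subset_of_nonneg (Finset.erase_subset_erase _ hsub)
            fun i hi _ => load_nonneg hβ0 (hy i (Finset.mem_of_mem_erase hi)).le
      _ = C * ∑ j, (if H t j = 0 then (0 : ℝ) else 1) := by
          rw [Finset.mul_sum, Finset.sum_filter]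
          refine Finset.sum_congr rfl fun j _ => ?_
          by_cases h : H t j = 0 <;> simp [h]
  have hε6 : ε ≤ 1 / 6 := by
    have hn : (1 : ℝ) ≤ n := by
      obtain ⟨i, -⟩ := L.exists_dist_eq_one
      exact_mod_cast i.pos
    exact hε.trans (div_le_self (by norm_num) hn)
  have h1 : (S₀.card : ℝ) * T
      ≤ 2 * ∑ i ∈ S₀, L.blockings M H i + ∑ i ∈ S₀, L.successes M H i + S₀.card * (T * ε) := by
    have h := Finset.sum_le_sum fun i (_ : i ∈ S₀) => le_blockings hP hT hH i
    rw [Finset.sum_add_distrib, Finset.sum_add_distrib, ← Finset.mul_sum] at h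
    simpa using h
  have h2 : ∑ i ∈ S₀, L.successes M H i ≤ T * V := by
    rw [← sum_successes hT]
    exact Finset.sum_le_sum_of_subset_of_nonneg (Finset.subset_univ _)
      fun i _ _ => successes_nonneg i
  have h3 : (S₀.card : ℝ) * (T * ε) ≤ S₀.card * (T * (1 / 6)) := by gcongr
  have h4 : C * ∑ j, transmissions H j ≤ C * (2 * (T * V) + T * (10 * V) / 6) := by
    refine mul_le_mul_of_nonneg_left ?_ (by linarith)
    refine (sum_transmissions_le hT hε hH).trans ?_
    have : (T : ℝ) * 1 ≤ T * (10 * V) := by gcongr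
    linarith
  have h5 : (T : ℝ) * S.card ≤ T * (20 * C * V) := by
    have hV0 : 0 ≤ T * V := by
      have : 0 ≤ V := by linarith
      positivity
    have h6 : (T : ℝ) * S.card ≤ T * (2 * S₀.card) := by gcongr
    nlinarith [mul_le_mul_of_nonneg_right hC0 hV0]
  have h7 := le_of_mul_le_mul_left h5 hT'
  rw [hC] at h7
  linarith

end Regret

/-! ### Feasible sets of links of nearly equal length -/

section Feasible

variable {n : ℕ} {L : LinkNetwork n} {M : RadioParams}

lemma received_nonneg (a : M.Profile n) (j i : Fin n) : 0 ≤ L.received M a j i := by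
  unfold received; positivity

lemma Succeeds.sum_received_le (hβ : 0 ≤ M.threshold) {a : M.Profile n} {i : Fin n}
    (h : L.Succeeds M a i) (S : Finset (Fin n)) :
    M.threshold * ∑ j ∈ S.erase i, L.received M a j i
      ≤ L.received M a i i - M.threshold * M.noise := by
  have h1 := h.2
  have h2 : ∑ j ∈ S.erase i, L.received M a j i ≤ ∑ j ∈ Finset.univ.erase i, L.received M a j i :=
    Finset.sum_le_sum_of_subset_of_nonneg (Finset.erase_subset_erase _ (Finset.subset_univ _))
      fun j _ _ => received_nonneg a j i
  have h3 := mul_le_mul_of_nonneg_left h2 hβ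
  linarith

lemma received_le (a : M.Profile n) (j i : Fin n) :
    L.received M a j i ≤ M.maxPower / L.gap j i ^ M.pathLoss := by
  have hg := gap_rpow_pos (L := L) j i M.pathLoss
  have hle : ((a j : ℕ) : ℝ) ≤ M.maxPower := by exact_mod_cast Nat.lt_succ_iff.1 (a j).isLt
  unfold received
  unfold gap at hg ⊢
  gcongr

/-- A link that overcomes the interference of another one has positive slack at maximum power. -/
lemma Succeeds.slack_pos (hβ : 0 < M.threshold) (hP : 0 < M.maxPower) {a : M.Profile n}
    {i j : Fin n} (hi : L.Succeeds M a i) (hj : L.Succeeds M a j) (hij : j ≠ i) :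
    0 < L.slack M i := by
  have hP' : (0 : ℝ) < M.maxPower := by exact_mod_cast hP
  have h := hi.sum_received_le hβ.le {i, j}
  have hs : ({i, j} : Finset (Fin n)).erase i = {j} := by
    rw [Finset.erase_insert]; simpa using hij.symm
  rw [hs, Finset.sum_singleton] at h
  have hj0 : (0 : ℝ) < (a j : ℕ) := by exact_mod_cast hj.1
  have hr : 0 < L.received M a j i := div_pos hj0 (gap_rpow_pos j i _)
  have h2 := received_le (L := L) a i i
  have h3 := mul_pos hβ hr
  have h4 : M.maxPower * L.slack M i
      = M.maxPower / L.gap i i ^ M.pathLoss - M.threshold * M.noise := by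
    unfold slack; field_simp
  have h5 : 0 < M.maxPower * L.slack M i := by linarith
  exact (mul_pos_iff_of_pos_left hP').1 h5

/-- Links that succeed together with at least half of the maximum power load one another
boundedly. -/
lemma sum_load_le_of_high_power (hβ : 1 < M.threshold) (hP : 0 < M.maxPower)
    {S : Finset (Fin n)} {a : M.Profile n} (hS : ∀ i ∈ S, L.Succeeds M a i)
    (hy : ∀ i ∈ S, 0 < L.slack M i) (ha : ∀ i ∈ S, (M.maxPower : ℝ) ≤ 2 * (a i : ℕ)) :
    ∑ i ∈ S, ∑ j ∈ S.erase i, L.load M (L.sender j) i ≤ 2 * S.card := by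
  have hβ0 : 0 < M.threshold := by linarith
  have hP' : (0 : ℝ) < M.maxPower := by exact_mod_cast hP
  rw [mul_comm, ← nsmul_eq_mul]
  refine Finset.sum_le_card_nsmul _ _ _ fun i hi => ?_
  have hyi := hy i hi
  have h1 := (hS i hi).sum_received_le hβ0.le S
  have h2 := received_le (L := L) a i i
  have h3 : M.maxPower * L.slack M i
      = M.maxPower / L.gap i i ^ M.pathLoss - M.threshold * M.noise := by
    unfold slack; field_simp
  have h4 : ∑ j ∈ S.erase i, L.load M (L.sender j) i
      ≤ 2 / (M.maxPower * L.slack M i) *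
        (M.threshold * ∑ j ∈ S.erase i, L.received M a j i) := by
    rw [Finset.mul_sum, Finset.mul_sum]
    refine Finset.sum_le_sum fun j hj => ?_
    have hg := gap_rpow_pos (L := L) j i M.pathLoss
    have haj := ha j (Finset.mem_of_mem_erase hj)
    unfold load received
    unfold gap at hg
    rw [show 2 / (M.maxPower * L.slack M i) * (M.threshold *
        (((a j : ℕ) : ℝ) / dist (L.sender j) (L.receiver i) ^ M.pathLoss))
        = M.threshold / (L.slack M i * dist (L.sender j) (L.receiver i) ^ M.pathLoss)
          * (2 * ((a j : ℕ) : ℝ) / M.maxPower) by field_simp]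
    refine le_mul_of_one_le_right (by positivity) ?_
    rwa [le_div_iff₀ hP', one_mul]
  refine h4.trans ?_
  calc 2 / (M.maxPower * L.slack M i) * (M.threshold * ∑ j ∈ S.erase i, L.received M a j i)
      ≤ 2 / (M.maxPower * L.slack M i) * (M.maxPower * L.slack M i) := by
        exact mul_le_mul_of_nonneg_left (by linarith) (by positivity)
    _ = 2 := by field_simp

/-- Two links of nearly equal length that succeed together: the two distances between them agree up
to a factor `21`. The product of the two SINR inequalities, in which the powers cancel, bounds the
product of these distances below. -/
lemma Succeeds.gap_le_mul_gap (hα : 0 < M.pathLoss) (hβ : 1 < M.threshold) (hN : 0 ≤ M.noise)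
    {a : M.Profile n} {i j : Fin n} (hi : L.Succeeds M a i) (hj : L.Succeeds M a j) (hij : j ≠ i)
    {R : ℝ} (hR : 0 < R) (hRi : R ≤ L.gap i i ∧ L.gap i i ≤ 2 * R)
    (hRj : R ≤ L.gap j j ∧ L.gap j j ≤ 2 * R) :
    L.gap i j ≤ 21 * L.gap j i := by
  have hβ0 : 0 < M.threshold := by linarith
  have key : ∀ i j : Fin n, L.Succeeds M a i → j ≠ i →
      (a j : ℕ) / L.gap j i ^ M.pathLoss ≤ (a i : ℕ) / L.gap i i ^ M.pathLoss := by
    intro i j hi hij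
    have h := hi.sum_received_le hβ0.le {i, j}
    have hs : ({i, j} : Finset (Fin n)).erase i = {j} := by
      rw [Finset.erase_insert]; simpa using hij.symm
    rw [hs, Finset.sum_singleton] at h
    have h1 := received_nonneg (L := L) a j i
    have h2 : 0 ≤ M.threshold * M.noise := by positivity
    have h3 : L.received M a j i ≤ L.received M a i i := by nlinarith
    exact h3
  have hai : (0 : ℝ) < (a i : ℕ) := by exact_mod_cast hi.1
  have haj : (0 : ℝ) < (a j : ℕ) := by exact_mod_cast hj.1
  have gij := gap_pos (L := L) i j
  have gji := gap_pos (L := L) j i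
  have gii := gap_pos (L := L) i i
  have gjj := gap_pos (L := L) j j
  have k1 := key i j hi hij
  have k2 := key j i hj hij.symm
  have hprod : L.gap i i * L.gap j j ≤ L.gap i j * L.gap j i := by
    refine le_of_not_gt fun hlt => ?_
    have hlt' := Real.rpow_lt_rpow (by positivity) hlt hα
    rw [Real.mul_rpow gij.le gji.le, Real.mul_rpow gii.le gjj.le] at hlt'
    have p1 := gap_rpow_pos (L := L) i i M.pathLoss
    have p2 := gap_rpow_pos (L := L) j j M.pathLoss
    have p3 := gap_rpow_pos (L := L) i j M.pathLoss
    have p4 := gap_rpow_pos (L := L) j i M.pathLoss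
    rw [div_le_div_iff₀ p4 p1] at k1
    rw [div_le_div_iff₀ p3 p2] at k2
    have h := mul_le_mul k1 k2 (by positivity) (by positivity)
    have h' : ((a i : ℕ) * (a j : ℕ) : ℝ) * (L.gap i i ^ M.pathLoss * L.gap j j ^ M.pathLoss)
        ≤ ((a i : ℕ) * (a j : ℕ) : ℝ) * (L.gap i j ^ M.pathLoss * L.gap j i ^ M.pathLoss) := by
      linarith
    exact absurd (le_of_mul_le_mul_left h' (by positivity)) (not_le.2 hlt')
  have htri := gap_le (L := L) i j
  have hRR : R * R ≤ L.gap i i * L.gap j j := mul_le_mul hRi.1 hRj.1 hR.le gii.le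
  have hfar : R ≤ 5 * L.gap j i := by
    by_contra! hlt
    have h1 : L.gap i j < 5 * R := by linarith
    nlinarith [mul_lt_mul'' h1 hlt gij.le (by positivity)]
  linarith

/-- Links of nearly equal length that succeed together, and for which the noise matters little at
maximum power, load one another boundedly: of two such links, one has at least the power of the
other and suffers about as much at equal powers. -/
lemma sum_load_le_of_low_noise (hα : 0 < M.pathLoss) (hβ : 1 < M.threshold) (hN : 0 ≤ M.noise)
    {S : Finset (Fin n)} {a : M.Profile n} (hS : ∀ i ∈ S, L.Succeeds M a i)
    {R : ℝ} (hR : 0 < R) (hlen : ∀ i ∈ S, R ≤ L.gap i i ∧ L.gap i i ≤ 2 * R)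
    (hy : ∀ i ∈ S, 1 / L.gap i i ^ M.pathLoss ≤ 2 * L.slack M i) :
    ∑ i ∈ S, ∑ j ∈ S.erase i, L.load M (L.sender j) i
      ≤ 4 * M.threshold * 42 ^ M.pathLoss * S.card := by
  have hβ0 : 0 < M.threshold := by linarith
  have h42 : (1 : ℝ) ≤ 42 ^ M.pathLoss := Real.one_le_rpow (by norm_num) hα.le
  have hP0 : ∀ i ∈ S, (0 : ℝ) < (a i : ℕ) := fun i hi => by exact_mod_cast (hS i hi).1
  -- `u i j` is the share of the signal of link `i` that the interference of link `j` uses up.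
  set u : Fin n → Fin n → ℝ := fun i j =>
    M.threshold * L.received M a j i / L.received M a i i with hu
  have hr : ∀ i ∈ S, ∀ j, 0 < L.received M a i j := fun i hi j =>
    div_pos (hP0 i hi) (gap_rpow_pos i j _)
  have hu0 : ∀ i ∈ S, ∀ j ∈ S, 0 ≤ u i j := fun i hi j hj => by
    have := hr i hi i
    have := hr j hj i
    simp only [hu]; positivity
  have hu1 : ∀ i ∈ S, ∑ j ∈ S.erase i, u i j ≤ 1 := fun i hi => by
    have h := (hS i hi).sum_received_le hβ0.le S
    have h2 : 0 ≤ M.threshold * M.noise := by positivity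
    simp only [hu]
    rw [← Finset.sum_div, ← Finset.mul_sum, div_le_one (hr i hi i)]
    linarith
  have hpow : ∀ i ∈ S, ∀ j ∈ S, ((a i : ℕ) : ℝ) ≤ (a j : ℕ) →
      (L.gap i i / L.gap j i) ^ M.pathLoss ≤ u i j := by
    intro i hi j hj hle
    have p1 := gap_rpow_pos (L := L) i i M.pathLoss
    have p2 := gap_rpow_pos (L := L) j i M.pathLoss
    have hai := hP0 i hi
    rw [Real.div_rpow (gap_pos i i).le (gap_pos j i).le]
    simp only [hu, received]
    change _ ≤ M.threshold * (((a j : ℕ) : ℝ) / L.gap j i ^ M.pathLoss)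
      / (((a i : ℕ) : ℝ) / L.gap i i ^ M.pathLoss)
    rw [show M.threshold * (((a j : ℕ) : ℝ) / L.gap j i ^ M.pathLoss)
        / (((a i : ℕ) : ℝ) / L.gap i i ^ M.pathLoss)
        = L.gap i i ^ M.pathLoss / L.gap j i ^ M.pathLoss
          * (M.threshold * (((a j : ℕ) : ℝ) / (a i : ℕ))) by field_simp]
    refine le_mul_of_one_le_right (by positivity) ?_
    have : 1 ≤ ((a j : ℕ) : ℝ) / (a i : ℕ) := by rwa [le_div_iff₀ hai, one_mul]
    nlinarith
  have hload : ∀ i ∈ S, ∀ j ∈ S, i ≠ j → L.load M (L.sender j) i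
      ≤ 2 * M.threshold * 42 ^ M.pathLoss * (u i j + u j i) := by
    intro i hi j hj hij
    have p1 := gap_rpow_pos (L := L) i i M.pathLoss
    have p2 := gap_rpow_pos (L := L) j i M.pathLoss
    have hyi := hy i hi
    have hy0 : 0 < L.slack M i := by
      have : 0 < 1 / L.gap i i ^ M.pathLoss := by positivity
      linarith
    have h1 : L.load M (L.sender j) i
        ≤ 2 * M.threshold * (L.gap i i / L.gap j i) ^ M.pathLoss := by
      rw [Real.div_rpow (gap_pos i i).le (gap_pos j i).le]
      change M.threshold / (L.slack M i * L.gap j i ^ M.pathLoss) ≤ _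
      rw [mul_div_assoc', div_le_div_iff₀ (by positivity) p2]
      rw [div_le_iff₀ p1] at hyi
      have := mul_le_mul_of_nonneg_left hyi (mul_pos hβ0 p2).le
      linarith
    have hij' := hu0 i hi j hj
    have hji' := hu0 j hj i hi
    have h2 : (L.gap i i / L.gap j i) ^ M.pathLoss ≤ 42 ^ M.pathLoss * (u i j + u j i) := by
      rcases le_total ((a i : ℕ) : ℝ) (a j : ℕ) with hle | hle
      · have h3 := hpow i hi j hj hle
        nlinarith
      · have h3 := hpow j hj i hi hle
        have h4 : (L.gap i i / L.gap j i) ^ M.pathLoss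
            ≤ 42 ^ M.pathLoss * (L.gap j j / L.gap i j) ^ M.pathLoss := by
          have gij := gap_pos (L := L) i j
          have gji := gap_pos (L := L) j i
          have gii := gap_pos (L := L) i i
          have gjj := gap_pos (L := L) j j
          rw [← Real.mul_rpow (by norm_num) (by positivity)]
          refine Real.rpow_le_rpow (by positivity) ?_ hα.le
          rw [mul_div_assoc', div_le_div_iff₀ gji gij]
          have h5 := (hS i hi).gap_le_mul_gap hα hβ hN (hS j hj) hij.symm hR (hlen i hi) (hlen j hj)
          have h6 : L.gap i i ≤ 2 * L.gap j j := by
            have := (hlen i hi).2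
            have := (hlen j hj).1
            linarith
          calc L.gap i i * L.gap i j ≤ (2 * L.gap j j) * (21 * L.gap j i) := by gcongr
            _ = _ := by ring
        nlinarith
    have h3 : 0 < 2 * M.threshold := by positivity
    nlinarith
  have hswap : ∑ i ∈ S, ∑ j ∈ S.erase i, u j i = ∑ j ∈ S, ∑ i ∈ S.erase j, u j i := by
    refine Finset.sum_comm' fun i j => ?_
    simp only [Finset.mem_erase]
    constructor
    · rintro ⟨h1, h2, h3⟩
      exact ⟨⟨h2.symm, h1⟩, h3⟩
    · rintro ⟨⟨h1, h2⟩, h3⟩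
      exact ⟨h2, h1.symm, h3⟩
  have hsum : ∑ i ∈ S, ∑ j ∈ S.erase i, u i j ≤ S.card := by
    simpa using Finset.sum_le_card_nsmul _ _ _ hu1
  calc ∑ i ∈ S, ∑ j ∈ S.erase i, L.load M (L.sender j) i
      ≤ ∑ i ∈ S, ∑ j ∈ S.erase i, 2 * M.threshold * 42 ^ M.pathLoss * (u i j + u j i) :=
        Finset.sum_le_sum fun i hi => Finset.sum_le_sum fun j hj =>
          hload i hi j (Finset.mem_of_mem_erase hj) (Finset.ne_of_mem_erase hj).symm
    _ = 2 * M.threshold * 42 ^ M.pathLoss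
        * (∑ i ∈ S, ∑ j ∈ S.erase i, u i j + ∑ j ∈ S, ∑ i ∈ S.erase j, u j i) := by
        simp only [← Finset.mul_sum, Finset.sum_add_distrib]
        rw [hswap]
    _ ≤ 2 * M.threshold * 42 ^ M.pathLoss * (S.card + S.card) := by gcongr
    _ = _ := by ring

end Feasible

/-! ### The upper bound -/

section UpperBound

variable {n : ℕ} {L : LinkNetwork n} {M : RadioParams}

lemma gap_self_le_maxLength (i : Fin n) : L.gap i i ≤ L.maxLength :=
  le_ciSup (f := fun i => dist (L.sender i) (L.receiver i)) (Set.finite_range _).bddAbove i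

lemma one_le_maxLength : 1 ≤ L.maxLength := by
  obtain ⟨i, -⟩ := L.exists_dist_eq_one
  exact (L.one_le_dist i i).trans (gap_self_le_maxLength i)

/-- A set of links of nearly equal length that succeed together is at most a constant factor larger
than the value of a low-regret history. The links for which the noise is a minor obstacle at maximum
power are treated apart from the others, which all need at least half of the maximum power. -/
lemma card_le_mul_value_of_succeeds (hα : 0 < M.pathLoss) (hβ : 1 < M.threshold)
    (hN : 0 ≤ M.noise) (hP : 0 < M.maxPower) {T : ℕ} {H : Fin T → M.Profile n} (hT : 0 < T) {ε : ℝ}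
    (hε : ε ≤ 1 / 6 / n) (hH : L.IsRegretHistory M ε H) (hV : 1 ≤ 10 * L.value M H)
    {S : Finset (Fin n)} {a : M.Profile n} (hS : ∀ i ∈ S, L.Succeeds M a i)
    (hy : ∀ i ∈ S, 0 < L.slack M i) {R : ℝ} (hR : 0 < R)
    (hlen : ∀ i ∈ S, R ≤ L.gap i i ∧ L.gap i i ≤ 2 * R) :
    (S.card : ℝ) ≤ 2 * (20 + 20 * 4 ^ M.pathLoss * (2 * (4 * M.threshold * 42 ^ M.pathLoss)))
      * L.value M H := by
  classical
  have hβ0 : 0 < M.threshold := by linarith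
  have hP' : (0 : ℝ) < M.maxPower := by exact_mod_cast hP
  have h42 : (1 : ℝ) ≤ 42 ^ M.pathLoss := Real.one_le_rpow (by norm_num) hα.le
  have hK : 2 ≤ 4 * M.threshold * 42 ^ M.pathLoss := by nlinarith
  set p : Fin n → Prop := fun i => 1 / L.gap i i ^ M.pathLoss ≤ 2 * L.slack M i
  have hsub : ∀ {q : Fin n → Prop} [DecidablePred q] {i}, i ∈ S.filter q → i ∈ S :=
    fun h => (Finset.mem_filter.1 h).1
  have hA := card_le_mul_value hα hβ hN hP hT hε hH hV (S := S.filter p)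
    (K := 4 * M.threshold * 42 ^ M.pathLoss) (fun i hi => hy i (hsub hi))
    (fun i hi => hlen i (hsub hi)) (by positivity)
    (sum_load_le_of_low_noise hα hβ hN (fun i hi => hS i (hsub hi)) hR
      (fun i hi => hlen i (hsub hi)) fun i hi => (Finset.mem_filter.1 hi).2)
  have hhigh : ∀ i ∈ S.filter fun i => ¬ p i, (M.maxPower : ℝ) ≤ 2 * (a i : ℕ) := by
    intro i hi
    have hpi : ¬ 1 / L.gap i i ^ M.pathLoss ≤ 2 * L.slack M i := (Finset.mem_filter.1 hi).2
    have hg := gap_rpow_pos (L := L) i i M.pathLoss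
    have h1 := (hS i (hsub hi)).sum_received_le hβ0.le ∅
    simp only [Finset.erase_empty, Finset.sum_empty, mul_zero] at h1
    have h2 : L.received M a i i = (a i : ℕ) / L.gap i i ^ M.pathLoss := rfl
    rw [h2] at h1
    have h3 : M.threshold * M.noise = M.maxPower * (M.threshold * M.noise / M.maxPower) := by
      field_simp
    unfold slack at hpi
    set z := M.threshold * M.noise / M.maxPower
    have h4 : 1 / L.gap i i ^ M.pathLoss ≤ 2 * z := by linarith
    have h5 : M.maxPower * (1 / L.gap i i ^ M.pathLoss)
        ≤ 2 * (a i : ℕ) * (1 / L.gap i i ^ M.pathLoss) := by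
      have h6 := mul_le_mul_of_nonneg_left h4 hP'.le
      have h7 : ((a i : ℕ) : ℝ) / L.gap i i ^ M.pathLoss
        = (a i : ℕ) * (1 / L.gap i i ^ M.pathLoss) := by ring
      linarith
    exact le_of_mul_le_mul_right h5 (by positivity)
  have hB := card_le_mul_value hα hβ hN hP hT hε hH hV (S := S.filter fun i => ¬ p i)
    (K := 4 * M.threshold * 42 ^ M.pathLoss) (fun i hi => hy i (hsub hi))
    (fun i hi => hlen i (hsub hi)) (by positivity)
    ((sum_load_le_of_high_power hβ hP (fun i hi => hS i (hsub hi)) (fun i hi => hy i (hsub hi))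
      hhigh).trans (by gcongr))
  have hcard : (S.card : ℝ) = (S.filter p).card + (S.filter fun i => ¬ p i).card := by
    exact_mod_cast (Finset.card_filter_add_card_filter_not (s := S) p).symm
  rw [hcard]
  linarith

/-- The constant of the upper bound, for path-loss exponent `α` and threshold `β`. -/
noncomputable def upperConst (α β : ℝ) : ℝ :=
  2 * (2 * (20 + 20 * 4 ^ α * (2 * (4 * β * 42 ^ α))))

lemma card_le_of_isFeasible (hα : 0 < M.pathLoss) (hβ : 1 < M.threshold)
    (hN : 0 ≤ M.noise) {T : ℕ} {H : Fin T → M.Profile n} (hT : 0 < T) {ε : ℝ}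
    (hε : ε ≤ 1 / 6 / n) (hH : L.IsRegretHistory M ε H)
    {A : Finset (Fin n)} (hA : L.IsFeasible M A) :
    (A.card : ℝ) ≤ upperConst M.pathLoss M.threshold * (1 + Real.log L.maxLength)
      * L.value M H := by
  classical
  have hβ0 : 0 < M.threshold := by linarith
  have hlog : 0 ≤ Real.log L.maxLength := Real.log_nonneg one_le_maxLength
  have hV0 : 0 ≤ L.value M H := by unfold value; positivity
  have hC : 80 ≤ upperConst M.pathLoss M.threshold := by
    have : 0 ≤ 20 * (4 : ℝ) ^ M.pathLoss * (2 * (4 * M.threshold * 42 ^ M.pathLoss)) := by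
      positivity
    unfold upperConst; linarith
  obtain ⟨a, -, ha⟩ := hA
  rcases A.eq_empty_or_nonempty with rfl | ⟨i₀, hi₀⟩
  · simp only [Finset.card_empty, Nat.cast_zero]; positivity
  have hP : 0 < M.maxPower := (ha i₀ hi₀).1.trans_le (Nat.lt_succ_iff.1 (a i₀).isLt)
  have hV : 1 ≤ 10 * L.value M H := by
    refine one_le_ten_mul_value hP hT hε hH (i := i₀) ?_
    have h1 := (ha i₀ hi₀).sum_received_le hβ0.le ∅
    simp only [Finset.erase_empty, Finset.sum_empty, mul_zero] at h1
    have h2 := received_le (L := L) a i₀ i₀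
    linarith
  -- The slack of a link may vanish, but only if that link is the whole feasible set.
  rcases le_or_gt A.card 1 with h1 | h1
  · have h2 : (A.card : ℝ) ≤ 1 := by exact_mod_cast h1
    have h3 : 10 * L.value M H
        ≤ upperConst M.pathLoss M.threshold * (1 + Real.log L.maxLength) * L.value M H := by
      refine mul_le_mul_of_nonneg_right ?_ hV0
      nlinarith
    linarith
  have hy : ∀ i ∈ A, 0 < L.slack M i := by
    intro i hi
    obtain ⟨j, hj, hji⟩ := A.exists_mem_ne h1 i
    exact (ha i hi).slack_pos hβ0 hP (ha j hj) hji
  set B := 2 * (20 + 20 * 4 ^ M.pathLoss * (2 * (4 * M.threshold * 42 ^ M.pathLoss)))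
    * L.value M H with hB
  have hBC : 2 * B = upperConst M.pathLoss M.threshold * L.value M H := by
    rw [hB]; unfold upperConst; ring
  -- Sort the links by the binary order of magnitude of their lengths.
  set f : Fin n → ℕ := fun i => ⌊Real.logb 2 (L.gap i i)⌋₊
  set m := ⌊Real.logb 2 L.maxLength⌋₊
  have hmaps : ∀ i ∈ A, f i ∈ Finset.range (m + 1) := fun i _ => by
    rw [Finset.mem_range, Nat.lt_succ_iff]
    exact Nat.floor_mono (Real.logb_le_logb_of_le (by norm_num) (gap_pos i i)
      (gap_self_le_maxLength i))
  have hclass : ∀ k ∈ Finset.range (m + 1),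
      (({i ∈ A | f i = k} : Finset (Fin n)).card : ℝ) ≤ B := by
    intro k _
    refine card_le_mul_value_of_succeeds hα hβ hN hP hT hε hH hV (a := a) (R := 2 ^ k)
      (fun i hi => ha i (Finset.mem_filter.1 hi).1) (fun i hi => hy i (Finset.mem_filter.1 hi).1)
      (by positivity) fun i hi => ?_
    have hfi : ⌊Real.logb 2 (L.gap i i)⌋₊ = k := (Finset.mem_filter.1 hi).2
    have hl0 : 0 ≤ Real.logb 2 (L.gap i i) := Real.logb_nonneg (by norm_num) (L.one_le_dist i i)
    have h2 := Nat.floor_le hl0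
    have h3 := (Nat.lt_floor_add_one (Real.logb 2 (L.gap i i))).le
    rw [hfi, Real.le_logb_iff_rpow_le (by norm_num) (gap_pos i i), Real.rpow_natCast] at h2
    rw [hfi, Real.logb_le_iff_le_rpow (by norm_num) (gap_pos i i), Real.rpow_add (by norm_num),
      Real.rpow_natCast, Real.rpow_one, mul_comm] at h3
    exact ⟨h2, h3⟩
  have hsum : (A.card : ℝ) ≤ (m + 1) * B := by
    rw [Finset.card_eq_sum_card_fiberwise hmaps, Nat.cast_sum]
    refine (Finset.sum_le_card_nsmul _ _ _ hclass).trans_eq ?_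
    simp
  have hm1 : (m : ℝ) + 1 ≤ 2 * (1 + Real.log L.maxLength) := by
    have h2 := Nat.floor_le (Real.logb_nonneg (b := 2) (by norm_num) (one_le_maxLength (L := L)))
    have h3 : Real.logb 2 L.maxLength ≤ 2 * Real.log L.maxLength := by
      unfold Real.logb
      rw [div_le_iff₀ (Real.log_pos (by norm_num))]
      nlinarith [Real.log_two_gt_d9]
    linarith
  have hB0 : 0 ≤ B := by rw [hB]; positivity
  calc (A.card : ℝ) ≤ (m + 1) * B := hsum
    _ ≤ 2 * (1 + Real.log L.maxLength) * B := by gcongr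
    _ = (1 + Real.log L.maxLength) * (2 * B) := by ring
    _ = _ := by rw [hBC]; ring

theorem priceOfTotalAnarchy_le (hα : 0 < M.pathLoss) (hβ : 1 < M.threshold) (hN : 0 ≤ M.noise)
    {ε : ℝ} (hε : ε ≤ 1 / 6 / n) :
    L.priceOfTotalAnarchy M ε
      ≤ ENNReal.ofReal (upperConst M.pathLoss M.threshold * (1 + Real.log L.maxLength)) := by
  classical
  have hlog : 0 ≤ Real.log L.maxLength := Real.log_nonneg one_le_maxLength
  have hβ0 : 0 < M.threshold := by linarith
  have hC : 0 < upperConst M.pathLoss M.threshold := by unfold upperConst; positivity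
  have hpos : 0 < upperConst M.pathLoss M.threshold * (1 + Real.log L.maxLength) := by positivity
  set C := upperConst M.pathLoss M.threshold * (1 + Real.log L.maxLength)
  obtain ⟨A, hA, hcard⟩ := Finset.exists_mem_eq_sup
    (Finset.univ.filter fun A : Finset (Fin n) => L.IsFeasible M A)
    ⟨∅, Finset.mem_filter.2 ⟨Finset.mem_univ _, fun _ => 0, fun _ _ => rfl, by simp⟩⟩ Finset.card
  have hopt : L.opt M = A.card := hcard
  refine ENNReal.div_le_of_le_mul ?_
  rw [← ENNReal.div_le_iff' (by simpa using hpos) ENNReal.ofReal_ne_top]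
  refine le_iInf fun T => le_iInf fun hT => le_iInf fun H => le_iInf fun hH => ?_
  rw [ENNReal.div_le_iff' (by simpa using hpos) ENNReal.ofReal_ne_top, ← ENNReal.ofReal_mul hpos.le,
    hopt, ← ENNReal.ofReal_natCast]
  exact ENNReal.ofReal_le_ofReal
    (card_le_of_isFeasible hα hβ hN hT hε hH (Finset.mem_filter.1 hA).2)

end UpperBound

/-! ### Nested links and the lower bound -/

section LowerBound

lemma dist_axis (x y : ℝ) : dist (!₂[-x, 0] : Plane) !₂[y, 0] = |x + y| := by
  rw [EuclideanSpace.dist_eq]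
  simp [Fin.sum_univ_two, Real.dist_eq, Real.sqrt_sq_eq_abs]
  rw [← abs_neg]; congr 1; ring

/-- Concentric links on a line, of lengths `1, ρ, …, ρ ^ m`: all senders are on one side of the
common centre and all receivers on the other side. -/
noncomputable def nested (m : ℕ) (ρ : ℝ) (hρ : 1 < ρ) : LinkNetwork (m + 1) where
  sender i := !₂[-(ρ ^ (i : ℕ) / 2), 0]
  receiver i := !₂[ρ ^ (i : ℕ) / 2, 0]
  distinct i j h := by
    have h1 : (!₂[ρ ^ (i : ℕ) / 2, 0] : Plane) = !₂[ρ ^ (j : ℕ) / 2, 0] := (Prod.ext_iff.1 h).2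
    have h2 : ρ ^ (i : ℕ) / 2 = ρ ^ (j : ℕ) / 2 := by
      simpa using congrArg (fun v : Plane => v 0) h1
    exact Fin.ext (pow_right_injective₀ (by linarith) hρ.ne' (by simpa using h2))
  one_le_dist i j := by
    rw [dist_axis]
    refine le_trans ?_ (le_abs_self _)
    have := one_le_pow₀ hρ.le (n := (i : ℕ))
    have := one_le_pow₀ hρ.le (n := (j : ℕ))
    linarith
  exists_dist_eq_one := ⟨0, 0, by rw [dist_axis]; norm_num⟩

variable {m : ℕ} {ρ : ℝ} (hρ : 1 < ρ)

lemma gap_nested (i j : Fin (m + 1)) :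
    (nested m ρ hρ).gap i j = (ρ ^ (i : ℕ) + ρ ^ (j : ℕ)) / 2 := by
  have : 0 < ρ := by linarith
  change dist (!₂[-(ρ ^ (i : ℕ) / 2), 0] : Plane) !₂[ρ ^ (j : ℕ) / 2, 0] = _
  rw [dist_axis, abs_of_pos (by positivity)]
  ring

lemma gap_nested_self (i : Fin (m + 1)) : (nested m ρ hρ).gap i i = ρ ^ (i : ℕ) := by
  rw [gap_nested]; ring

lemma maxLength_nested : (nested m ρ hρ).maxLength = ρ ^ m := by
  refine le_antisymm (ciSup_le fun i => ?_) ?_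
  · have h := gap_nested_self hρ i
    unfold gap at h
    rw [h]
    exact pow_le_pow_right₀ hρ.le (Nat.lt_succ_iff.1 i.isLt)
  · have h := gap_self_le_maxLength (L := nested m ρ hρ) (Fin.last m)
    rwa [gap_nested_self, Fin.val_last] at h

variable {M : RadioParams}

/-- The profile in which the shortest link transmits at maximum power and the others are silent. -/
def shortestOnly (M : RadioParams) (m : ℕ) : M.Profile (m + 1) := Pi.single 0 (Fin.last _)

lemma succeeds_shortestOnly (hP : 0 < M.maxPower) (hN : M.threshold * M.noise ≤ M.maxPower) :
    (nested m ρ hρ).Succeeds M (shortestOnly M m) 0 := by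
  refine ⟨by simpa [shortestOnly] using hP, ?_⟩
  rw [Finset.sum_eq_zero]
  · have h := gap_nested_self hρ (m := m) 0
    unfold gap at h
    simpa [received, h, shortestOnly] using hN
  · intro j hj
    have hj' := Finset.ne_of_mem_erase hj
    simp [received, shortestOnly, hj']

/-- The shortest link at maximum power blocks every other link, at whatever power: its sender is at
least as close to every receiver as the intended sender is. -/
lemma not_succeeds_of_shortest (hα : 0 < M.pathLoss) (hβ : 1 < M.threshold) (hN : 0 ≤ M.noise)
    (hP : 0 < M.maxPower) {a : M.Profile (m + 1)} (h0 : a 0 = Fin.last _) {i : Fin (m + 1)}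
    (hi : i ≠ 0) : ¬ (nested m ρ hρ).Succeeds M a i := by
  intro h
  have hβ0 : 0 < M.threshold := by linarith
  have hP' : (0 : ℝ) < M.maxPower := by exact_mod_cast hP
  have h1 := h.sum_received_le hβ0.le {i, 0}
  have hs : ({i, 0} : Finset (Fin (m + 1))).erase i = {0} := by
    rw [Finset.erase_insert]; simpa using hi
  rw [hs, Finset.sum_singleton] at h1
  have h2 : (nested m ρ hρ).received M a i i ≤ (nested m ρ hρ).received M a 0 i := by
    refine (received_le a i i).trans ?_
    have h3 : (nested m ρ hρ).received M a 0 i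
        = M.maxPower / (nested m ρ hρ).gap 0 i ^ M.pathLoss := by
      simp [received, h0, gap]
    have hg := gap_pos (L := nested m ρ hρ) 0 i
    rw [h3]
    have hle : (nested m ρ hρ).gap 0 i ≤ (nested m ρ hρ).gap i i := by
      rw [gap_nested, gap_nested_self]
      have := one_le_pow₀ hρ.le (n := (i : ℕ))
      simp only [Fin.val_zero, pow_zero]
      linarith
    gcongr
  have h3 : 0 < (nested m ρ hρ).received M a 0 i := by
    refine div_pos ?_ (gap_rpow_pos 0 i _)
    simpa [h0] using hP
  have h4 : 0 ≤ M.threshold * M.noise := by positivity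
  nlinarith

/-- In the equilibrium in which only the shortest link transmits, one link is successful. -/
lemma worstRegretValue_nested_le (hα : 0 < M.pathLoss) (hβ : 1 < M.threshold) (hN : 0 ≤ M.noise)
    (hP : 0 < M.maxPower) (hNP : M.threshold * M.noise ≤ M.maxPower) {ε : ℝ} (hε : 0 ≤ ε) :
    (nested m ρ hρ).worstRegretValue M ε ≤ 1 := by
  classical
  have hs := succeeds_shortestOnly hρ (m := m) hP hNP
  have hregret : (nested m ρ hρ).IsRegretHistory M ε fun _ : Fin 1 => shortestOnly M m := by
    intro i
    refine le_trans ?_ hε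
    unfold regret
    simp only [Nat.cast_one, div_one, one_mul, Finset.univ_unique, Finset.sum_singleton]
    rw [sub_nonpos]
    refine ciSup_le fun s => ?_
    by_cases hi : i = 0
    · subst hi
      have : (nested m ρ hρ).utility M (shortestOnly M m) 0 = 1 := by
        simp [utility, hs, hs.ne_zero]
      rw [this]
      unfold utility
      split_ifs <;> norm_num
    · have h0 : (nested m ρ hρ).utility M (shortestOnly M m) i = 0 := by
        simp [utility, shortestOnly, hi]
      have hf := not_succeeds_of_shortest hρ hα hβ hN hP (i := i)
        (a := Function.update (shortestOnly M m) i s)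
        (by rw [Function.update_of_ne (Ne.symm hi)]; simp [shortestOnly]) hi
      rw [h0]
      unfold utility
      simp only [hf, if_false]
      split_ifs <;> norm_num
  unfold worstRegretValue
  refine (iInf₂_le_of_le 1 one_pos (iInf₂_le _ hregret)).trans ?_
  rw [ENNReal.ofReal_le_one]
  unfold value
  simp only [Nat.cast_one, div_one, one_mul, Finset.univ_unique, Finset.sum_singleton]
  rw [Nat.cast_le_one, Finset.card_le_one]
  have h : ∀ i, (nested m ρ hρ).Succeeds M (shortestOnly M m) i → i = 0 := fun i hi => by
    by_contra hne
    exact not_succeeds_of_shortest hρ hα hβ hN hP (by simp [shortestOnly]) hne hi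
  intro i hi j hj
  rw [h i (Finset.mem_filter.1 hi).2, h j (Finset.mem_filter.1 hj).2]

lemma IsFeasible.card_le_opt {n : ℕ} {L : LinkNetwork n} {A : Finset (Fin n)}
    (hA : L.IsFeasible M A) : A.card ≤ L.opt M := by
  classical
  exact Finset.le_sup (f := Finset.card) (Finset.mem_filter.2 ⟨Finset.mem_univ A, hA⟩)

lemma one_le_opt_nested (hP : 0 < M.maxPower) (hNP : M.threshold * M.noise ≤ M.maxPower) :
    1 ≤ (nested m ρ hρ).opt M := by
  have h : (nested m ρ hρ).IsFeasible M {0} :=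
    ⟨shortestOnly M m, fun i hi => by
      simp only [Finset.mem_singleton] at hi
      simp [shortestOnly, hi], by
      simpa using succeeds_shortestOnly hρ hP hNP⟩
  simpa using h.card_le_opt

/-- Powers growing like the square root of the signal attenuation let geometrically growing links
coexist: with `g` the growth rate of the powers, the interference at link `i` is geometrically
decreasing on either side of `i`. -/
lemma sum_pow_div_sq_max_le {g : ℝ} (hg : 1 < g) (i : Fin (m + 1)) :
    ∑ j ∈ Finset.univ.erase i, g ^ (j : ℕ) / max (g ^ (i : ℕ)) (g ^ (j : ℕ)) ^ 2
      ≤ 2 / (g - 1) / g ^ (i : ℕ) := by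
  have hg0 : 0 < g := by linarith
  have hg1 : 0 < g - 1 := by linarith
  set t : ℕ → ℝ := fun j => g ^ j / max (g ^ (i : ℕ)) (g ^ j) ^ 2 with ht
  have hmap : ∑ j ∈ Finset.univ.erase i, t j
      = ∑ j ∈ (Finset.range (m + 1)).erase (i : ℕ), t j := by
    refine Finset.sum_bij (fun j _ => (j : ℕ)) ?_ ?_ ?_ ?_
    · intro j hj
      simpa [Fin.ext_iff] using ⟨fun h => Finset.ne_of_mem_erase hj (Fin.ext h), by omega⟩
    · intro j _ k _ h
      exact Fin.ext h
    · intro j hj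
      simp only [Finset.mem_erase, Finset.mem_range] at hj
      exact ⟨⟨j, hj.2⟩, by simpa [Fin.ext_iff] using hj.1, rfl⟩
    · intro j _
      rfl
  have hsplit : (Finset.range (m + 1)).erase (i : ℕ)
      = Finset.range i ∪ Finset.Ico ((i : ℕ) + 1) (m + 1) := by
    ext j
    have := i.isLt
    simp only [Finset.mem_erase, Finset.mem_range, Finset.mem_union, Finset.mem_Ico]
    omega
  have hdisj : Disjoint (Finset.range (i : ℕ)) (Finset.Ico ((i : ℕ) + 1) (m + 1)) := by
    rw [Finset.disjoint_left]
    intro j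
    simp only [Finset.mem_range, Finset.mem_Ico]
    omega
  have hlow : ∑ j ∈ Finset.range (i : ℕ), t j ≤ 1 / (g - 1) / g ^ (i : ℕ) := by
    have h1 : ∑ j ∈ Finset.range (i : ℕ), t j
        = (∑ j ∈ Finset.range (i : ℕ), g ^ j) / (g ^ (i : ℕ)) ^ 2 := by
      rw [Finset.sum_div]
      refine Finset.sum_congr rfl fun j hj => ?_
      simp only [ht]
      rw [max_eq_left (pow_le_pow_right₀ hg.le (Finset.mem_range.1 hj).le)]
    rw [h1, geom_sum_eq hg.ne', div_div, div_div, div_le_div_iff₀ (by positivity) (by positivity)]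
    have : 0 < g ^ (i : ℕ) := by positivity
    nlinarith [mul_pos hg1 this]
  have hhigh : ∑ j ∈ Finset.Ico ((i : ℕ) + 1) (m + 1), t j ≤ 1 / (g - 1) / g ^ (i : ℕ) := by
    have h1 : ∑ j ∈ Finset.Ico ((i : ℕ) + 1) (m + 1), t j
        = ∑ j ∈ Finset.Ico ((i : ℕ) + 1) (m + 1), g⁻¹ ^ j := by
      refine Finset.sum_congr rfl fun j hj => ?_
      have hij : (i : ℕ) ≤ j := by
        have := (Finset.mem_Ico.1 hj).1
        omega
      simp only [ht]
      rw [max_eq_right (pow_le_pow_right₀ hg.le hij), inv_pow]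
      field_simp
    rw [h1]
    refine (geom_sum_Ico_le_of_lt_one (by positivity) (inv_lt_one_of_one_lt₀ hg)).trans_eq ?_
    rw [inv_pow, pow_succ]
    field_simp
  change ∑ j ∈ Finset.univ.erase i, t j ≤ _
  rw [hmap, hsplit, Finset.sum_union hdisj]
  calc _ ≤ 1 / (g - 1) / g ^ (i : ℕ) + 1 / (g - 1) / g ^ (i : ℕ) := add_le_add hlow hhigh
    _ = _ := by ring

/-- The power scale that overcomes the noise and makes rounding to integers harmless. -/
noncomputable def powerScale (M : RadioParams) (g : ℝ) (m : ℕ) : ℝ :=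
  1 + 2 * M.threshold * M.noise * g ^ m

/-- With a large enough growth rate, all nested links can succeed together. -/
lemma isFeasible_nested (hα : 0 < M.pathLoss) (hβ : 1 < M.threshold) (hN : 0 ≤ M.noise)
    {g : ℝ} (hg : g = ρ ^ (M.pathLoss / 2))
    (hgβ : 1 + 8 * M.threshold * 2 ^ M.pathLoss ≤ g)
    (hP : ⌈powerScale M g m * g ^ m⌉₊ ≤ M.maxPower) :
    (nested m ρ hρ).IsFeasible M Finset.univ := by
  have hβ0 : 0 < M.threshold := by linarith
  have hρ0 : 0 < ρ := by linarith
  have hpos : 0 < 8 * M.threshold * 2 ^ M.pathLoss := by positivity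
  have hg1 : 1 < g := by linarith
  have hg0 : 0 < g := by linarith
  have hN' : 0 ≤ M.threshold * M.noise := by positivity
  set W := powerScale M g m with hW
  have hW1 : 1 ≤ W := by
    have : 0 ≤ 2 * M.threshold * M.noise * g ^ m := by positivity
    rw [hW]; unfold powerScale; linarith
  have hpow : ∀ i : Fin (m + 1), g ^ (i : ℕ) ≤ g ^ m := fun i =>
    pow_le_pow_right₀ hg1.le (Nat.lt_succ_iff.1 i.isLt)
  have hone : ∀ i : Fin (m + 1), 1 ≤ g ^ (i : ℕ) := fun i => one_le_pow₀ hg1.le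
  have hsq : ∀ k : ℕ, (ρ ^ k) ^ M.pathLoss = (g ^ k) ^ 2 := fun k => by
    rw [hg, ← Real.rpow_natCast ρ, ← Real.rpow_natCast (ρ ^ (M.pathLoss / 2)),
      ← Real.rpow_mul hρ0.le, ← Real.rpow_mul hρ0.le, ← Real.rpow_natCast _ 2, ← Real.rpow_mul hρ0.le]
    congr 1
    push_cast
    ring
  have hlt : ∀ i : Fin (m + 1), ⌈W * g ^ (i : ℕ)⌉₊ < M.maxPower + 1 := fun i =>
    Nat.lt_succ_iff.2 ((Nat.ceil_mono (mul_le_mul_of_nonneg_left (hpow i) (by linarith))).trans hP)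
  refine ⟨fun i => ⟨⌈W * g ^ (i : ℕ)⌉₊, hlt i⟩, by simp, fun i _ => ⟨?_, ?_⟩⟩
  · have := hone i
    simp only [Nat.ceil_pos]
    positivity
  set a : M.Profile (m + 1) := fun i => ⟨⌈W * g ^ (i : ℕ)⌉₊, hlt i⟩ with ha
  have hlow : W / g ^ (i : ℕ) ≤ (nested m ρ hρ).received M a i i := by
    change _ ≤ ((⌈W * g ^ (i : ℕ)⌉₊ : ℕ) : ℝ) / (nested m ρ hρ).gap i i ^ M.pathLoss
    rw [gap_nested_self, hsq]
    calc W / g ^ (i : ℕ) = W * g ^ (i : ℕ) / (g ^ (i : ℕ)) ^ 2 := by field_simp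
      _ ≤ _ := by gcongr; exact Nat.le_ceil _
  have hterm : ∀ j, (nested m ρ hρ).received M a j i
      ≤ 2 * W * 2 ^ M.pathLoss * (g ^ (j : ℕ) / max (g ^ (i : ℕ)) (g ^ (j : ℕ)) ^ 2) := by
    intro j
    change ((⌈W * g ^ (j : ℕ)⌉₊ : ℕ) : ℝ) / (nested m ρ hρ).gap j i ^ M.pathLoss ≤ _
    have hc : ((⌈W * g ^ (j : ℕ)⌉₊ : ℕ) : ℝ) ≤ 2 * W * g ^ (j : ℕ) := by
      have h1 := (Nat.ceil_lt_add_one (by positivity : 0 ≤ W * g ^ (j : ℕ))).le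
      have h2 := hone j
      nlinarith
    have hmax : max (g ^ (i : ℕ)) (g ^ (j : ℕ)) ^ 2
        ≤ 2 ^ M.pathLoss * (nested m ρ hρ).gap j i ^ M.pathLoss := by
      rw [← Real.mul_rpow (by norm_num) (gap_pos j i).le, gap_nested]
      rcases max_choice (g ^ (i : ℕ)) (g ^ (j : ℕ)) with h | h <;> rw [h, ← hsq]
      · refine Real.rpow_le_rpow (by positivity) ?_ hα.le
        have : 0 < ρ ^ (j : ℕ) := by positivity
        linarith
      · refine Real.rpow_le_rpow (by positivity) ?_ hα.le
        have : 0 < ρ ^ (i : ℕ) := by positivity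
        linarith
    have hgp := gap_rpow_pos (L := nested m ρ hρ) j i M.pathLoss
    have hm0 : 0 < max (g ^ (i : ℕ)) (g ^ (j : ℕ)) := lt_max_of_lt_left (by positivity)
    rw [mul_div_assoc', div_le_div_iff₀ hgp (by positivity)]
    calc ((⌈W * g ^ (j : ℕ)⌉₊ : ℕ) : ℝ) * max (g ^ (i : ℕ)) (g ^ (j : ℕ)) ^ 2
        ≤ (2 * W * g ^ (j : ℕ)) * (2 ^ M.pathLoss * (nested m ρ hρ).gap j i ^ M.pathLoss) := by
          gcongr
      _ = _ := by ring
  have hsum : ∑ j ∈ Finset.univ.erase i, (nested m ρ hρ).received M a j i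
      ≤ 2 * W * 2 ^ M.pathLoss * (2 / (g - 1) / g ^ (i : ℕ)) := by
    refine (Finset.sum_le_sum fun j _ => hterm j).trans ?_
    rw [← Finset.mul_sum]
    exact mul_le_mul_of_nonneg_left (sum_pow_div_sq_max_le hg1 i) (by positivity)
  have hint : M.threshold * (2 * W * 2 ^ M.pathLoss * (2 / (g - 1) / g ^ (i : ℕ)))
      ≤ W / g ^ (i : ℕ) / 2 := by
    have hg1' : 0 < g - 1 := by linarith
    have hgi : 0 < g ^ (i : ℕ) := by positivity
    rw [show M.threshold * (2 * W * 2 ^ M.pathLoss * (2 / (g - 1) / g ^ (i : ℕ)))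
      = W / g ^ (i : ℕ) / 2 * (8 * M.threshold * 2 ^ M.pathLoss / (g - 1)) by
        field_simp; norm_num]
    refine mul_le_of_le_one_right (by positivity) ?_
    rw [div_le_one hg1']
    linarith
  have hnoise : M.threshold * M.noise ≤ W / g ^ (i : ℕ) / 2 := by
    rw [div_div, le_div_iff₀ (by positivity)]
    have h1 := mul_le_mul_of_nonneg_left (hpow i) hN'
    have h2 : W = 1 + 2 * M.threshold * M.noise * g ^ m := by rw [hW]; rfl
    linarith
  have := mul_le_mul_of_nonneg_left hsum hβ0.le
  linarith

/-- Every `Δ ≥ 1` is a power `ρ ^ m` with a ratio `ρ` above a given bound `q` and `m` of order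
`log Δ`; for small `Δ`, where this is impossible, `m ≤ 1` will do. -/
lemma exists_pow_eq {q Δ : ℝ} (hq : 1 < q) (hΔ : 1 ≤ Δ) :
    ∃ (m : ℕ) (ρ : ℝ), 1 < ρ ∧ ρ ^ m = Δ ∧ (q ≤ ρ ∨ m ≤ 1)
      ∧ Real.log Δ ≤ (m + 1) * Real.log q := by
  have hlq : 0 < Real.log q := Real.log_pos hq
  have hΔ0 : 0 < Δ := by linarith
  rcases hΔ.eq_or_lt with rfl | hΔ1
  · exact ⟨0, 2, by norm_num, by norm_num, Or.inr zero_le_one, by simpa using hlq.le⟩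
  rcases lt_or_ge Δ q with hlt | hge
  · refine ⟨1, Δ, hΔ1, pow_one _, Or.inr le_rfl, ?_⟩
    have := Real.log_le_log hΔ0 hlt.le
    push_cast
    linarith
  · set m := ⌊Real.log Δ / Real.log q⌋₊
    have h1 : 1 ≤ Real.log Δ / Real.log q := by
      rw [le_div_iff₀ hlq, one_mul]
      exact Real.log_le_log (by linarith) hge
    have hm1 : 1 ≤ m := Nat.le_floor (by simpa using h1)
    have hm0 : (0 : ℝ) < m := by exact_mod_cast hm1
    have hfl : (m : ℝ) ≤ Real.log Δ / Real.log q := Nat.floor_le (by linarith)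
    have hqρ : q ≤ Δ ^ (1 / (m : ℝ)) := by
      rw [Real.le_rpow_iff_log_le (by linarith) hΔ0]
      rw [le_div_iff₀ hlq] at hfl
      rw [one_div, inv_mul_eq_div, le_div_iff₀ hm0]
      linarith
    refine ⟨m, Δ ^ (1 / (m : ℝ)), hq.trans_le hqρ, ?_, Or.inl hqρ, ?_⟩
    · rw [← Real.rpow_natCast, ← Real.rpow_mul hΔ0.le, one_div_mul_cancel hm0.ne', Real.rpow_one]
    · have h2 := (Nat.lt_floor_add_one (Real.log Δ / Real.log q)).le
      rwa [div_le_iff₀ hlq] at h2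

/-- The ratio of lengths that makes the nested links feasible together, for path-loss exponent `α`
and threshold `β`. -/
noncomputable def nestedRatio (α β : ℝ) : ℝ := (1 + 8 * β * 2 ^ α) ^ (2 / α)

lemma one_lt_nestedRatio {α β : ℝ} (hα : 0 < α) (hβ : 1 < β) : 1 < nestedRatio α β := by
  have : 0 < 8 * β * 2 ^ α := by positivity
  exact Real.one_lt_rpow (by linarith) (by positivity)

theorem exists_le_priceOfTotalAnarchy {α β N Δ : ℝ} (hα : 0 < α) (hβ : 1 < β) (hN : 0 ≤ N)
    (hΔ : 1 ≤ Δ) :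
    ∃ (n : ℕ) (L : LinkNetwork n) (P₀ : ℕ), L.maxLength = Δ ∧
      ∀ Pmax : ℕ, P₀ ≤ Pmax → ∀ ε : ℝ, 0 ≤ ε →
        ENNReal.ofReal (1 / (2 * (1 + Real.log (nestedRatio α β))) * (1 + Real.log Δ))
          ≤ L.priceOfTotalAnarchy ⟨α, β, N, Pmax⟩ ε := by
  have hq := one_lt_nestedRatio hα hβ
  have hlq : 0 < Real.log (nestedRatio α β) := Real.log_pos hq
  obtain ⟨m, ρ, hρ, hpow, hcase, hlog⟩ := exists_pow_eq hq hΔ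
  set g := ρ ^ (α / 2) with hg
  have hg1 : 1 ≤ g := Real.one_le_rpow hρ.le (by positivity)
  set W := powerScale ⟨α, β, N, 0⟩ g m
  have hWg : 1 ≤ W * g ^ m ∧ β * N ≤ W * g ^ m := by
    have h1 : 1 ≤ g ^ m := one_le_pow₀ hg1
    have h2 : 0 ≤ β * N := by positivity
    have h3 : W = 1 + 2 * β * N * g ^ m := rfl
    have h4 : β * N ≤ β * N * g ^ m := le_mul_of_one_le_right h2 h1
    have h5 : W ≤ W * g ^ m := le_mul_of_one_le_right (by linarith) h1
    constructor <;> linarith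
  refine ⟨m + 1, nested m ρ hρ, ⌈W * g ^ m⌉₊, by rw [maxLength_nested, hpow], ?_⟩
  intro P hP ε hε
  set M : RadioParams := ⟨α, β, N, P⟩
  have hPW : W * g ^ m ≤ P := Nat.ceil_le.1 hP
  have hP0 : 0 < M.maxPower := by
    have : (0 : ℝ) < P := by linarith
    exact_mod_cast this
  have hNP : M.threshold * M.noise ≤ M.maxPower := hWg.2.trans hPW
  have hval := worstRegretValue_nested_le hρ (m := m) (M := M) hα hβ hN hP0 hNP hε
  have hopt1 := one_le_opt_nested hρ (m := m) (M := M) hP0 hNP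
  have hbound : 1 + Real.log Δ
      ≤ 2 * (1 + Real.log (nestedRatio α β)) * ((nested m ρ hρ).opt M : ℝ) := by
    have ho : (1 : ℝ) ≤ ((nested m ρ hρ).opt M : ℝ) := by exact_mod_cast hopt1
    rcases hcase with hqρ | hm
    · have hf : (nested m ρ hρ).IsFeasible M Finset.univ := by
        refine isFeasible_nested hρ hα hβ hN (g := g) rfl ?_ hP
        have h1 := Real.rpow_le_rpow (by linarith) hqρ (by positivity : 0 ≤ α / 2)
        rwa [nestedRatio, ← Real.rpow_mul (by positivity),
          show 2 / α * (α / 2) = 1 by field_simp, Real.rpow_one] at h1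
      have h2 : m + 1 ≤ (nested m ρ hρ).opt M := by simpa using hf.card_le_opt
      have h3 : ((m : ℝ) + 1) ≤ ((nested m ρ hρ).opt M : ℝ) := by exact_mod_cast h2
      nlinarith
    · have hm1 : (m : ℝ) ≤ 1 := by
        exact_mod_cast hm
      nlinarith
  unfold priceOfTotalAnarchy
  calc ENNReal.ofReal (1 / (2 * (1 + Real.log (nestedRatio α β))) * (1 + Real.log Δ))
      ≤ ENNReal.ofReal ((nested m ρ hρ).opt M : ℝ) := by
        refine ENNReal.ofReal_le_ofReal ?_
        rw [one_div, inv_mul_eq_div, div_le_iff₀ (by positivity)]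
        linarith
    _ = ((nested m ρ hρ).opt M : ℝ≥0∞) / 1 := by rw [ENNReal.ofReal_natCast, div_one]
    _ ≤ _ := ENNReal.div_le_div_left hval _

end LowerBound

end LinkNetwork

theorem mainTheorem11 :
    ∃ ε₀ : ℝ, 0 < ε₀ ∧
      ∀ α β : ℝ, 0 < α → 1 < β →
        ∃ c C : ℝ, 0 < c ∧ 0 < C ∧
          (∀ (N : ℝ) (Pmax n : ℕ) (L : LinkNetwork n) (ε : ℝ),
            0 ≤ N → 0 ≤ ε → ε ≤ ε₀ / n →
              L.priceOfTotalAnarchy ⟨α, β, N, Pmax⟩ ε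
                ≤ ENNReal.ofReal (C * (1 + Real.log L.maxLength))) ∧
          (∀ N Δ : ℝ, 0 ≤ N → 1 ≤ Δ →
            ∃ (n : ℕ) (L : LinkNetwork n) (P₀ : ℕ), L.maxLength = Δ ∧
              ∀ Pmax : ℕ, P₀ ≤ Pmax → ∀ ε : ℝ, 0 ≤ ε →
                ENNReal.ofReal (c * (1 + Real.log Δ))
                  ≤ L.priceOfTotalAnarchy ⟨α, β, N, Pmax⟩ ε) := by
  refine ⟨1 / 6, by norm_num, fun α β hα hβ => ?_⟩
  refine ⟨1 / (2 * (1 + Real.log (LinkNetwork.nestedRatio α β))), LinkNetwork.upperConst α β,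
    ?_, ?_, fun N P n L ε hN _ hε => ?_, fun N Δ hN hΔ => ?_⟩
  · have := Real.log_pos (LinkNetwork.one_lt_nestedRatio hα hβ)
    positivity
  · have : 0 < β := by linarith
    unfold LinkNetwork.upperConst
    positivity
  · exact LinkNetwork.priceOfTotalAnarchy_le (M := ⟨α, β, N, P⟩) hα hβ hN hε
  · exact LinkNetwork.exists_le_priceOfTotalAnarchy hα hβ hN hΔ
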